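/- Let $\Gamma\subset \mathrm{PSL}(2,\mathbb{R})$ be a Fuchsian group (a discrete subgroup) of type $(p,k:\nu_1,\dots,\nu_k)$ with $\nu_i\in\{2,3,\dots,\infty\}$. That is, $\mathbb{H}/\Gamma$, with its punctures filled in, is a closed surface of genus $p$, and the cone points of $\mathbb{H}/\Gamma$ are exactly $k$ points, of orders $\nu_1,\dots,\nu_k$, where a cone point of order $\infty$ means a puncture (an orbit of cusps of $\Gamma$). Let $k_0$ be the number of indices $i$ with $\nu_i=\infty$. Suppose that $\Gamma$ contains the element $\left[\begin{pmatrix}1&1\\0&1\end{pmatrix}\right]$ and that this element is not a power, with exponent a natural number, of any other element of $\Gamma$. Then there exists $\left[\begin{pmatrix}a&b\\c&d\end{pmatrix}\right]\in\Gamma$ such that $$1\le |c| < \mathrm{Area}(\mathbb{H}/\Gamma)-k_0+1,$$ where $\mathrm{Area}(\mathbb{H}/\Gamma)$ is the hyperbolic area of $\mathbb{H}/\Gamma$, taken with respect to $dx\,dy/y^2$ on $\mathbb{H}$. -/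

import Mathlib

open scoped MatrixGroups UpperHalfPlane

noncomputable section

namespace Fuchsian

open Matrix MeasureTheory

/-- The inclusion `SL(2, ℝ) → GL(2, ℝ)`. -/
abbrev toGL2 : SL(2, ℝ) →* GL (Fin 2) ℝ := SpecialLinearGroup.toGL

/-- The quotient map `SL(2, ℝ) → PSL(2, ℝ)`, sending a matrix to its class up to sign. -/
abbrev proj : SL(2, ℝ) →* PSL(2, ℝ) :=
  QuotientGroup.mk' (Subgroup.center SL(2, ℝ))

/-- `PSL(2, ℝ)` acts on the upper half-plane by Möbius transformations. -/
instance pslActionUpperHalfPlane : MulAction PSL(2, ℝ) ℍ :=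
  MulAction.compHom ℍ (ProjectiveSpecialLinearGroup.toPGL (n := Fin 2) (R := ℝ))

theorem proj_smul (g : SL(2, ℝ)) (z : ℍ) : proj g • z = g • z :=
  UpperHalfPlane.pglMk_smul (toGL2 g) z

theorem scalar_smul_onePoint (u : ℝˣ) (x : OnePoint ℝ) :
    GeneralLinearGroup.scalar (Fin 2) u • x = x := by
  induction x using OnePoint.rec with
  | infty => simp [OnePoint.smul_infty_eq_self_iff]
  | coe t => simp [OnePoint.smul_some_eq_ite]

/-- `PSL(2, ℝ)` acts on the boundary `ℝ ∪ {∞}` by Möbius transformations. -/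
instance pslActionBoundary : MulAction PSL(2, ℝ) (OnePoint ℝ) :=
  letI : MulAction PGL(2, ℝ) (OnePoint ℝ) :=
    ProjGenLinGroup.mulActionOfGL scalar_smul_onePoint
  MulAction.compHom (OnePoint ℝ) (ProjectiveSpecialLinearGroup.toPGL (n := Fin 2) (R := ℝ))

theorem proj_smul_boundary (g : SL(2, ℝ)) (x : OnePoint ℝ) : proj g • x = toGL2 g • x :=
  rfl

/-- The full preimage in `GL(2, ℝ)` (inside `SL(2, ℝ)`) of a subgroup of `PSL(2, ℝ)`. -/
def matrixGroup (Γ : Subgroup PSL(2, ℝ)) : Subgroup (GL (Fin 2) ℝ) :=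
  (Γ.comap proj).map toGL2

/-- The cusps of `Γ`: the points of `ℝ ∪ {∞}` fixed by a parabolic element of `Γ`. -/
def Cusp (Γ : Subgroup PSL(2, ℝ)) : Type :=
  {c : OnePoint ℝ // IsCusp c (matrixGroup Γ)}

theorem isCusp_smul {Γ : Subgroup PSL(2, ℝ)} (g : Γ) {c : OnePoint ℝ}
    (hc : IsCusp c (matrixGroup Γ)) : IsCusp ((g : PSL(2, ℝ)) • c) (matrixGroup Γ) := by
  obtain ⟨g, hg⟩ := g
  obtain ⟨h, rfl⟩ := QuotientGroup.mk'_surjective (Subgroup.center SL(2, ℝ)) g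
  exact hc.smul_of_mem (g := toGL2 h) ⟨h, hg, rfl⟩

/-- The extended half-plane of `Γ`: the upper half-plane together with the cusps of `Γ`. -/
inductive ExtendedHalfPlane (Γ : Subgroup PSL(2, ℝ)) : Type
  | point (z : ℍ) : ExtendedHalfPlane Γ
  | cusp (c : Cusp Γ) : ExtendedHalfPlane Γ

namespace ExtendedHalfPlane

variable {Γ : Subgroup PSL(2, ℝ)}

/-- `Γ` acts on its extended half-plane. -/
instance : MulAction Γ (ExtendedHalfPlane Γ) where
  smul g w :=
    match w with
    | point z => point ((g : PSL(2, ℝ)) • z)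
    | cusp c => cusp ⟨(g : PSL(2, ℝ)) • c.1, isCusp_smul g c.2⟩
  one_smul w := by
    cases w with
    | point z => exact congrArg point (one_smul PSL(2, ℝ) z)
    | cusp c => exact congrArg cusp (Subtype.ext (one_smul PSL(2, ℝ) c.1))
  mul_smul g h w := by
    cases w with
    | point z => exact congrArg point (mul_smul (g : PSL(2, ℝ)) (h : PSL(2, ℝ)) z)
    | cusp c =>
      exact congrArg cusp (Subtype.ext (mul_smul (g : PSL(2, ℝ)) (h : PSL(2, ℝ)) c.1))

/-- The horoball topology on the extended half-plane. A set is open when its trace on `ℍ` is open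
and it contains, with every cusp `c = σ ∞` (`σ ∈ SL(2, ℝ)`), a horoball `σ {z | A ≤ Im z}`
at `c`. -/
instance : TopologicalSpace (ExtendedHalfPlane Γ) where
  IsOpen V := IsOpen {z : ℍ | point z ∈ V} ∧
    ∀ (σ : SL(2, ℝ)) (h : IsCusp (toGL2 σ • (OnePoint.infty : OnePoint ℝ)) (matrixGroup Γ)),
      cusp ⟨_, h⟩ ∈ V → ∀ᶠ z in UpperHalfPlane.atImInfty, point (σ • z) ∈ V
  isOpen_univ := by simp
  isOpen_inter U V hU hV :=
    ⟨hU.1.inter hV.1, fun σ h hc => (hU.2 σ h hc.1).and (hV.2 σ h hc.2)⟩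
  isOpen_sUnion S hS := by
    refine ⟨?_, ?_⟩
    · have : {z : ℍ | point z ∈ ⋃₀ S} = ⋃ V ∈ S, {z : ℍ | (point z : ExtendedHalfPlane Γ) ∈ V} := by
        ext z; simp
      rw [this]
      exact isOpen_biUnion fun V hV => (hS V hV).1
    · rintro σ h ⟨V, hV, hc⟩
      exact ((hS V hV).2 σ h hc).mono fun z hz => ⟨V, hV, hz⟩

end ExtendedHalfPlane

/-- The surface obtained from `ℍ / Γ` by filling in its punctures: the quotient of the extended
half-plane by `Γ`, with the quotient topology. -/
abbrev CompletedQuotient (Γ : Subgroup PSL(2, ℝ)) : Type :=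
  MulAction.orbitRel.Quotient Γ (ExtendedHalfPlane Γ)

/-- `X` has genus `p`: its first singular homology with rational coefficients has dimension `2 p`.
For a connected closed orientable surface this says that it is a sphere with `p` handles. -/
def HasGenus (X : Type) [TopologicalSpace X] (p : ℕ) : Prop :=
  Module.rank ℚ
    (((AlgebraicTopology.singularHomologyFunctor (ModuleCat.{0} ℚ) 1).obj
      (ModuleCat.of ℚ ℚ)).obj (TopCat.of X)) = ((2 * p : ℕ) : Cardinal)

/-- `Γ` is a Fuchsian group of type `(p, k : ν₁, …, ν_k)`: it is a discrete subgroup of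
`PSL(2, ℝ)`, filling in the punctures of `ℍ / Γ` gives a closed surface of genus `p`, and the cone
points of `ℍ / Γ` (the punctures being the cone points of order `∞`) are exactly `k` points
`x₁, …, x_k` of that surface, of orders `ν₁, …, ν_k`. The order of a point is the order of the
stabilizer in `Γ` of a point of the extended half-plane lying over it; this is `∞` at the cusps. -/
structure IsOfType (Γ : Subgroup PSL(2, ℝ)) (p k : ℕ) (ν : Fin k → ℕ∞) : Prop where
  discrete : DiscreteTopology Γ
  compact : CompactSpace (CompletedQuotient Γ)
  genus : HasGenus (CompletedQuotient Γ) p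
  two_le : ∀ i, 2 ≤ ν i
  conePoints : ∃ x : Fin k → ExtendedHalfPlane Γ,
    (∀ i j, MulAction.orbit Γ (x i) = MulAction.orbit Γ (x j) → i = j) ∧
    (∀ i, ENat.card (MulAction.stabilizer Γ (x i)) = ν i) ∧
    (∀ w, MulAction.stabilizer Γ w ≠ ⊥ → ∃ i, w ∈ MulAction.orbit Γ (x i))

/-- The hyperbolic area of `ℍ / Γ`: the area, for `dx dy / y²`, of a fundamental domain. -/
def area (Γ : Subgroup PSL(2, ℝ)) : ℝ :=
  (covolume Γ ℍ (volume : Measure ℍ)).toReal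

/-- The class in `PSL(2, ℝ)` of the matrix `(1 1; 0 1)`. -/
def translation : PSL(2, ℝ) :=
  proj ⟨!![1, 1; 0, 1], by simp [Matrix.det_fin_two]⟩

end Fuchsian

end

/-! ### Unipotent matrices, Shimizu's lemma and normalization of cusps -/

noncomputable section

namespace Fuchsian

open Matrix MeasureTheory Filter Topology

/-! The argument packs horoballs and compares areas. Move each cusp to `∞` so that its stabilizer is
generated, up to sign, by the unit translation. Shimizu's lemma (`one_le_abs_of_shift_mem`) makes
the horoballs at height 1 in these coordinates, with all their translates, pairwise disjoint or
equal. A horoball at height `h` covers area `1 / h` of the quotient, so this already accounts for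
area `k₀`.

Suppose now that every nonzero lower left entry has absolute value at least `C ≥ 1`. Then the
horoball at `∞` can be lowered to height `1 / C` and the packing survives
(`isHoroballPacking_of_cusps`). The cusp regions now have total area `C + (k₀ - 1)`. Horoballs
cannot fill the half-plane, so the area of the quotient is strictly larger
(`IsHoroballPacking.sum_lt_area`). If the theorem failed, `C = max 1 (area - k₀ + 1)` would be
admissible, which is a contradiction.

The area is a `toReal`, so its finiteness has to be proved; it comes from compactness of the
completed quotient (`volume_fundamentalDomain_ne_top`). -/

/-- The unipotent matrix `(1 x; 0 1)`. -/
def shift (x : ℝ) : SL(2, ℝ) := ⟨!![1, x; 0, 1], by simp [Matrix.det_fin_two]⟩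

theorem coe_shift (x : ℝ) : (shift x : Matrix (Fin 2) (Fin 2) ℝ) = !![1, x; 0, 1] := rfl

theorem proj_shift_one : proj (shift 1) = translation := rfl

theorem det_eq (g : SL(2, ℝ)) : g 0 0 * g 1 1 - g 0 1 * g 1 0 = 1 := by
  rw [← Matrix.det_fin_two, g.det_coe]

theorem coe_inv_eq (g : SL(2, ℝ)) :
    ((g⁻¹ : SL(2, ℝ)) : Matrix (Fin 2) (Fin 2) ℝ) = !![g 1 1, -g 0 1; -g 1 0, g 0 0] := by
  rw [Matrix.SpecialLinearGroup.coe_inv, Matrix.adjugate_fin_two]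

theorem coe_mul_eq (g h : SL(2, ℝ)) :
    ((g * h : SL(2, ℝ)) : Matrix (Fin 2) (Fin 2) ℝ) =
      !![g 0 0 * h 0 0 + g 0 1 * h 1 0, g 0 0 * h 0 1 + g 0 1 * h 1 1;
         g 1 0 * h 0 0 + g 1 1 * h 1 0, g 1 0 * h 0 1 + g 1 1 * h 1 1] := by
  rw [Matrix.SpecialLinearGroup.coe_mul]
  ext i j
  fin_cases i <;> fin_cases j <;> simp [Matrix.mul_apply, Fin.sum_univ_two]

theorem shift_add (x y : ℝ) : shift (x + y) = shift x * shift y := by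
  apply Subtype.ext
  rw [coe_mul_eq]
  simp [coe_shift, add_comm]

theorem shift_zero : shift 0 = 1 := by
  apply Subtype.ext
  simp [coe_shift, Matrix.one_fin_two]

theorem shift_neg (x : ℝ) : shift (-x) = (shift x)⁻¹ := by
  rw [eq_inv_iff_mul_eq_one, ← shift_add, neg_add_cancel, shift_zero]

theorem shift_zpow (x : ℝ) (n : ℤ) : shift (n * x) = shift x ^ n := by
  let f : Multiplicative ℝ →* SL(2, ℝ) :=
    { toFun := fun x => shift x.toAdd
      map_one' := shift_zero
      map_mul' := fun x y => shift_add _ _ }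
  have := map_zpow f (Multiplicative.ofAdd x) n
  rw [← ofAdd_zsmul, zsmul_eq_mul] at this
  exact this

theorem shift_injective : Function.Injective shift := by
  intro x y h
  have := congrArg (fun g : SL(2, ℝ) => g 0 1) h
  simpa [coe_shift] using this

theorem continuous_shift : Continuous shift := by
  refine Continuous.subtype_mk ?_ _
  refine continuous_matrix fun i j => ?_
  fin_cases i <;> fin_cases j <;> simp <;> fun_prop

theorem conj_shift (g : SL(2, ℝ)) (x : ℝ) :
    ((g * shift x * g⁻¹ : SL(2, ℝ)) : Matrix (Fin 2) (Fin 2) ℝ) =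
      !![1 - x * g 0 0 * g 1 0, x * g 0 0 ^ 2; -x * g 1 0 ^ 2, 1 + x * g 0 0 * g 1 0] := by
  have := det_eq g
  rw [coe_mul_eq, coe_inv_eq, coe_mul_eq, coe_shift]
  ext i j
  fin_cases i <;> fin_cases j <;> simp <;> first | linear_combination this | ring

theorem mem_center_iff_eq (g : SL(2, ℝ)) : g ∈ Subgroup.center SL(2, ℝ) ↔ g = 1 ∨ g = -1 := by
  rw [Matrix.SpecialLinearGroup.mem_center_iff]
  constructor
  · rintro ⟨r, hr, hg⟩
    rw [Fintype.card_fin, sq_eq_one_iff] at hr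
    rcases hr with rfl | rfl
    · left; apply Subtype.ext; rw [← hg]; simp
    · right; apply Subtype.ext; rw [← hg]; ext i j; fin_cases i <;> fin_cases j <;> simp
  · rintro (rfl | rfl)
    · exact ⟨1, by simp, by simp⟩
    · exact ⟨-1, by simp, by ext i j; fin_cases i <;> fin_cases j <;> simp⟩

theorem proj_eq_proj_iff (g h : SL(2, ℝ)) : proj g = proj h ↔ g = h ∨ g = -h := by
  rw [eq_comm]
  simp only [proj, QuotientGroup.mk'_apply, QuotientGroup.eq, mem_center_iff_eq]
  rw [inv_mul_eq_one, inv_mul_eq_iff_eq_mul, mul_neg, mul_one, eq_comm]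

theorem proj_neg (g : SL(2, ℝ)) : proj (-g) = proj g := (proj_eq_proj_iff _ _).2 (Or.inr rfl)

theorem proj_surjective : Function.Surjective proj := QuotientGroup.mk'_surjective _

/-- A neighbourhood isolating the identity in `Γ` pulls back to one isolating `{1, -1}`; removing
the closed point `-1` leaves the identity alone. -/
instance discreteTopology_comap_proj (Γ : Subgroup PSL(2, ℝ)) [h : DiscreteTopology Γ] :
    DiscreteTopology (Γ.comap proj) := by
  apply discreteTopology_of_isOpen_singleton_one
  have h1 : IsOpen ({1} : Set Γ) := isOpen_discrete _
  obtain ⟨V, hV, hV1⟩ := isOpen_induced_iff.1 h1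
  have hc : Continuous proj := continuous_quot_mk
  have h2 : IsOpen ({-1}ᶜ : Set SL(2, ℝ)) := isClosed_singleton.isOpen_compl
  have h3 := ((hV.preimage hc).inter h2).preimage
    (continuous_subtype_val (p := fun g => g ∈ Γ.comap proj))
  convert! h3 using 1
  ext ⟨g, hg⟩
  have h4 : proj g ∈ V ↔ proj g = 1 := by
    have := Set.ext_iff.1 hV1 ⟨proj g, hg⟩
    simpa [Subtype.ext_iff] using this
  have h5 : proj g = 1 ↔ g = 1 ∨ g = -1 := by rw [← proj_eq_proj_iff, map_one]
  have h6 : (1 : SL(2, ℝ)) ≠ -1 := by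
    intro h
    have := congrArg (fun g : SL(2, ℝ) => g 0 0) h
    norm_num at this
  simp only [Set.mem_singleton_iff, Set.mem_preimage, Set.mem_inter_iff, Set.mem_compl_iff, h4, h5,
    Subtype.ext_iff]
  change g = 1 ↔ _
  constructor
  · rintro rfl; exact ⟨Or.inl rfl, h6⟩
  · rintro ⟨h | h, h'⟩
    · exact h
    · exact absurd h h'

/-- The conjugate `σ⁻¹ H σ`. -/
def conj (H : Subgroup SL(2, ℝ)) (σ : SL(2, ℝ)) : Subgroup SL(2, ℝ) :=
  H.comap (MulAut.conj σ).toMonoidHom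

theorem mem_conj {H : Subgroup SL(2, ℝ)} {σ g : SL(2, ℝ)} : g ∈ conj H σ ↔ σ * g * σ⁻¹ ∈ H :=
  Iff.rfl

instance discreteTopology_conj (H : Subgroup SL(2, ℝ)) [DiscreteTopology H] (σ : SL(2, ℝ)) :
    DiscreteTopology (conj H σ) := by
  let f : conj H σ → H := fun g => ⟨σ * g * σ⁻¹, g.2⟩
  refine DiscreteTopology.of_continuous_injective (f := f) ?_ ?_
  · exact Continuous.subtype_mk (by fun_prop) _
  · rintro ⟨g, hg⟩ ⟨g', hg'⟩ h
    have := congrArg Subtype.val h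
    simpa [f] using this

section

variable {H : Subgroup SL(2, ℝ)} [DiscreteTopology H]

theorem eventually_eq_of_tendsto {u : ℕ → SL(2, ℝ)} {t : SL(2, ℝ)} (hu : ∀ n, u n ∈ H)
    (ht : t ∈ H) (h : Tendsto u atTop (𝓝 t)) : ∀ᶠ n in atTop, u n = t := by
  have h1 : Tendsto (fun n => (⟨u n, hu n⟩ : H)) atTop (𝓝 ⟨t, ht⟩) := by
    rwa [tendsto_subtype_rng]
  rw [nhds_discrete, tendsto_pure] at h1
  exact h1.mono fun n hn => congrArg Subtype.val hn

theorem tendsto_of_entries {u : ℕ → SL(2, ℝ)} {t : SL(2, ℝ)}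
    (h : ∀ i j, Tendsto (fun n => u n i j) atTop (𝓝 (t i j))) : Tendsto u atTop (𝓝 t) := by
  refine tendsto_subtype_rng.2 ?_
  exact tendsto_pi_nhds.2 fun i => tendsto_pi_nhds.2 fun j => h i j

/-- **Shimizu's lemma.** -/
theorem one_le_abs_of_shift_mem (hT : shift 1 ∈ H) {g : SL(2, ℝ)} (hg : g ∈ H)
    (hc : g 1 0 ≠ 0) : 1 ≤ |g 1 0| := by
  by_contra! hlt
  -- Iterated conjugation of the translation squares the lower left entry up to sign. If that entry
  -- is below 1 in absolute value, the iterates converge to `shift 1` without reaching it,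
  -- contradicting discreteness.
  let u : ℕ → SL(2, ℝ) := fun n => (fun x => x * shift 1 * x⁻¹)^[n] g
  have hus : ∀ n, u (n + 1) = u n * shift 1 * (u n)⁻¹ := fun n =>
    Function.iterate_succ_apply' _ _ _
  have hu : ∀ n, u n ∈ H := by
    intro n
    induction n with
    | zero => exact hg
    | succ n ih => rw [hus]; exact H.mul_mem (H.mul_mem ih hT) (H.inv_mem ih)
  have e10 : ∀ n, u (n + 1) 1 0 = - u n 1 0 ^ 2 := fun n => by
    rw [hus, conj_shift]; simp
  have e00 : ∀ n, u (n + 1) 0 0 = 1 - u n 0 0 * u n 1 0 := fun n => by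
    rw [hus, conj_shift]; simp
  have e11 : ∀ n, u (n + 1) 1 1 = 1 + u n 0 0 * u n 1 0 := fun n => by
    rw [hus, conj_shift]; simp
  have e01 : ∀ n, u (n + 1) 0 1 = u n 0 0 ^ 2 := fun n => by
    rw [hus, conj_shift]; simp
  set q := |g 1 0| with hq
  have hq0 : 0 ≤ q := abs_nonneg _
  have hcn : ∀ n, |u n 1 0| ≤ q ^ (n + 1) := by
    intro n
    induction n with
    | zero => simp [u, hq]
    | succ n ih =>
      rw [e10, abs_neg, abs_pow]
      calc |u n 1 0| ^ 2 ≤ (q ^ (n + 1)) ^ 2 := by gcongr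
        _ = q ^ (2 * n + 2) := by ring
        _ ≤ q ^ (n + 1 + 1) := pow_le_pow_of_le_one hq0 hlt.le (by omega)
  have hcq : ∀ n, |u n 1 0| ≤ q := fun n =>
    (hcn n).trans (by simpa using pow_le_pow_of_le_one hq0 hlt.le (Nat.le_add_left 1 n))
  -- Any `M ≥ 1 / (1 - q)` satisfies `1 + M * q ≤ M`, so the bound `M` on the upper left entry is
  -- inherited by each iterate.
  set M := max |g 0 0| (1 / (1 - q)) with hM
  have h1q : 0 < 1 - q := by linarith
  have hM1 : 1 + M * q ≤ M := by
    have : 1 / (1 - q) ≤ M := le_max_right _ _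
    rw [div_le_iff₀ h1q] at this
    linarith
  have han : ∀ n, |u n 0 0| ≤ M := by
    intro n
    induction n with
    | zero => exact le_max_left _ _
    | succ n ih =>
      rw [e00]
      calc |1 - u n 0 0 * u n 1 0| ≤ |1| + |u n 0 0 * u n 1 0| := abs_sub _ _
        _ ≤ 1 + M * q := by
          rw [abs_one, abs_mul]
          have := mul_le_mul ih (hcq n) (abs_nonneg _) ((abs_nonneg _).trans ih)
          linarith
        _ ≤ M := hM1
  have tc : Tendsto (fun n => u n 1 0) atTop (𝓝 0) := by
    refine squeeze_zero_norm hcn ?_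
    exact (tendsto_pow_atTop_nhds_zero_of_lt_one hq0 hlt).comp (tendsto_add_atTop_nat 1)
  have tac : Tendsto (fun n => u n 0 0 * u n 1 0) atTop (𝓝 0) := by
    refine squeeze_zero_norm (a := fun n => M * |u n 1 0|) (fun n => ?_) ?_
    · rw [Real.norm_eq_abs, abs_mul]
      exact mul_le_mul_of_nonneg_right (han n) (abs_nonneg _)
    · simpa using (tc.abs).const_mul M
  have ta : Tendsto (fun n => u n 0 0) atTop (𝓝 1) := by
    rw [← tendsto_add_atTop_iff_nat 1]
    simp only [e00]
    simpa using tac.const_sub 1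
  have key : Tendsto (fun n => u (n + 1)) atTop (𝓝 (shift 1)) := by
    apply tendsto_of_entries
    intro i j
    fin_cases i <;> fin_cases j
    · simpa [e00, coe_shift] using tac.const_sub 1
    · simpa [e01, coe_shift] using ta.pow 2
    · simpa [e10, coe_shift] using (tc.pow 2).neg
    · simpa [e11, coe_shift] using tac.const_add 1
  obtain ⟨n, hn⟩ := (eventually_eq_of_tendsto (fun n => hu (n + 1)) hT key).exists
  have h0 : ∀ n, u n 1 0 ≠ 0 := by
    intro n
    induction n with
    | zero => exact hc
    | succ n ih => rw [e10]; exact neg_ne_zero.2 (pow_ne_zero 2 ih)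
  apply h0 (n + 1)
  rw [hn, coe_shift]
  simp

theorem conj_upper (g : SL(2, ℝ)) (hc : g 1 0 = 0) (x : ℝ) :
    g * shift x * g⁻¹ = shift (g 0 0 ^ 2 * x) := by
  apply Subtype.ext
  rw [conj_shift, coe_shift, hc]
  ext i j
  fin_cases i <;> fin_cases j <;> simp [mul_comm]

/-- Conjugation by `g` multiplies translation lengths by the square of the diagonal entry. A
contraction would produce arbitrarily short nonzero translations in `H`. -/
theorem one_le_abs_of_upper {x : ℝ} (hx : x ≠ 0) (hT : shift x ∈ H) {g : SL(2, ℝ)} (hg : g ∈ H)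
    (hc : g 1 0 = 0) : 1 ≤ |g 0 0| := by
  by_contra! hlt
  have hd := det_eq g
  have ha : g 0 0 ≠ 0 := by
    intro h
    simp [h, hc] at hd
  have hlt2 : g 0 0 ^ 2 < 1 := by rwa [sq_lt_one_iff_abs_lt_one]
  have hu : ∀ n : ℕ, shift ((g 0 0 ^ 2) ^ n * x) ∈ H := by
    intro n
    induction n with
    | zero => simpa using hT
    | succ n ih =>
      have := H.mul_mem (H.mul_mem hg ih) (H.inv_mem hg)
      rw [conj_upper g hc] at this
      rwa [pow_succ', mul_assoc]
  have key : Tendsto (fun n : ℕ => shift ((g 0 0 ^ 2) ^ n * x)) atTop (𝓝 1) := by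
    rw [← shift_zero]
    refine (continuous_shift.tendsto 0).comp ?_
    simpa using (tendsto_pow_atTop_nhds_zero_of_lt_one (sq_nonneg _) hlt2).mul_const x
  obtain ⟨n, hn⟩ := (eventually_eq_of_tendsto hu H.one_mem key).exists
  rw [← shift_zero] at hn
  have := shift_injective hn
  simp [ha, hx] at this

theorem eq_shift_of_upper {x : ℝ} (hx : x ≠ 0) (hT : shift x ∈ H) {g : SL(2, ℝ)} (hg : g ∈ H)
    (hc : g 1 0 = 0) : ∃ b, g = shift b ∨ g = -shift b := by
  have h1 := one_le_abs_of_upper hx hT hg hc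
  -- The inverse has the other diagonal entry in the corner. The two entries have product 1, so both
  -- bounds are equalities.
  have h2 := one_le_abs_of_upper hx hT (H.inv_mem hg) (by rw [coe_inv_eq]; simp [hc])
  rw [coe_inv_eq] at h2
  simp only [of_apply, cons_val', cons_val_zero, cons_val_fin_one] at h2
  have hd := det_eq g
  rw [hc, mul_zero, sub_zero] at hd
  have h3 : |g 0 0| * |g 1 1| = 1 := by rw [← abs_mul, hd, abs_one]
  have h4 : |g 0 0| = 1 := by nlinarith
  rcases eq_or_eq_neg_of_abs_eq h4 with h | h
  · refine ⟨g 0 1, Or.inl (Subtype.ext ?_)⟩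
    have : g 1 1 = 1 := by rw [h] at hd; linarith
    rw [coe_shift]
    ext i j
    fin_cases i <;> fin_cases j <;> simp [h, hc, this]
  · refine ⟨-g 0 1, Or.inr (Subtype.ext ?_)⟩
    have : g 1 1 = -1 := by rw [h] at hd; linarith
    rw [Matrix.SpecialLinearGroup.coe_neg, coe_shift]
    ext i j
    fin_cases i <;> fin_cases j <;> simp [h, hc, this]

/-- The translation lengths of the unipotent upper triangular elements of `H`. -/
def translations (H : Subgroup SL(2, ℝ)) : AddSubgroup ℝ where
  carrier := {x | shift x ∈ H}
  zero_mem' := by simp [shift_zero, H.one_mem]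
  add_mem' := fun {x y} hx hy => by
    simp only [Set.mem_ofPred_eq, shift_add] at *; exact H.mul_mem hx hy
  neg_mem' := fun {x} hx => by
    simp only [Set.mem_ofPred_eq, shift_neg] at *; exact H.inv_mem hx

theorem exists_generator_translations {x : ℝ} (hx : x ≠ 0) (hT : shift x ∈ H) :
    ∃ w > 0, shift w ∈ H ∧ ∀ y, shift y ∈ H → ∃ n : ℤ, y = n * w := by
  have : DiscreteTopology (translations H) := by
    let f : translations H → H := fun y => ⟨shift y, y.2⟩
    refine DiscreteTopology.of_continuous_injective (f := f) ?_ ?_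
    · exact Continuous.subtype_mk (continuous_shift.comp continuous_subtype_val) _
    · rintro ⟨y, hy⟩ ⟨z, hz⟩ h
      exact Subtype.ext (shift_injective (congrArg Subtype.val h))
  have hcyc := AddSubgroup.discrete_iff_addCyclic.2 this
  obtain ⟨⟨w, hw⟩, hgen⟩ := hcyc.exists_generator
  have hg : ∀ y, shift y ∈ H → ∃ n : ℤ, y = n * w := fun y hy => by
    obtain ⟨n, hn⟩ := AddSubgroup.mem_zmultiples_iff.1 (hgen ⟨y, hy⟩)
    refine ⟨n, ?_⟩
    have := congrArg Subtype.val hn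
    simpa using this.symm
  have hw0 : w ≠ 0 := by
    rintro rfl
    obtain ⟨n, hn⟩ := hg x hT
    exact hx (by simpa using hn)
  rcases hw0.lt_or_gt with h | h
  · refine ⟨-w, by simpa using h, (translations H).neg_mem hw, fun y hy => ?_⟩
    obtain ⟨n, hn⟩ := hg y hy
    exact ⟨-n, by push_cast; linarith⟩
  · exact ⟨w, h, hw, hg⟩

theorem conj_conj (H : Subgroup SL(2, ℝ)) (σ τ : SL(2, ℝ)) :
    conj (conj H σ) τ = conj H (σ * τ) := by
  ext g
  simp only [mem_conj, _root_.mul_inv_rev, mul_assoc]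

/-- Conjugating by the diagonal matrix with entries `√w` and `1 / √w` rescales the shortest
translation length `w` to 1. -/
theorem exists_normalized {x : ℝ} (hx : x ≠ 0) (hT : shift x ∈ H) (hneg : -1 ∈ H) :
    ∃ δ : SL(2, ℝ), δ 1 0 = 0 ∧ shift 1 ∈ conj H δ ∧
      ∀ g ∈ conj H δ, g 1 0 = 0 → ∃ n : ℤ, g = shift n ∨ g = -shift n := by
  obtain ⟨w, hw, hwH, hgen⟩ := exists_generator_translations hx hT
  have hs : √w ≠ 0 := (Real.sqrt_pos.2 hw).ne'
  let δ : SL(2, ℝ) := ⟨!![√w, 0; 0, (√w)⁻¹], by simp [Matrix.det_fin_two, hs]⟩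
  have hδ : δ 1 0 = 0 := by simp [δ]
  have hδ0 : δ 0 0 ^ 2 = w := by simp [δ, Real.sq_sqrt hw.le]
  have hc : ∀ y, shift y ∈ conj H δ ↔ shift (w * y) ∈ H := fun y => by
    rw [mem_conj, conj_upper δ hδ, hδ0]
  have h1 : shift 1 ∈ conj H δ := by rw [hc]; simpa using hwH
  have hn : -1 ∈ conj H δ := by rw [mem_conj]; simpa using hneg
  refine ⟨δ, hδ, h1, fun g hg hg0 => ?_⟩
  obtain ⟨b, hb⟩ := eq_shift_of_upper one_ne_zero h1 hg hg0
  have hbm : shift b ∈ conj H δ := by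
    rcases hb with rfl | rfl
    · exact hg
    · have := (conj H δ).mul_mem hn hg
      simpa using this
  rw [hc] at hbm
  obtain ⟨n, hn⟩ := hgen _ hbm
  have : b = n := mul_left_cancel₀ hw.ne' (by linarith)
  exact ⟨n, this ▸ hb⟩

end

theorem neg_one_mem_comap (Γ : Subgroup PSL(2, ℝ)) : -1 ∈ Γ.comap proj := by
  rw [Subgroup.mem_comap, proj_neg, map_one]
  exact Γ.one_mem

theorem smul_infty_eq_iff (σ τ : SL(2, ℝ)) :
    toGL2 σ • (OnePoint.infty : OnePoint ℝ) = toGL2 τ • OnePoint.infty ↔ (τ⁻¹ * σ) 1 0 = 0 := by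
  rw [← inv_smul_eq_iff, ← map_inv, smul_smul, ← map_mul, OnePoint.smul_infty_eq_self_iff]
  rfl

theorem exists_smul_infty_eq (c : OnePoint ℝ) :
    ∃ σ : SL(2, ℝ), toGL2 σ • (OnePoint.infty : OnePoint ℝ) = c :=
  OnePoint.exists_mem_SL2 ℝ c

/-- A cusp can be moved to `∞` so that its stabilizer becomes generated by the unit translation,
up to sign. -/
theorem exists_cusp_normalization {Γ : Subgroup PSL(2, ℝ)} [DiscreteTopology Γ] {c : OnePoint ℝ}
    (hc : IsCusp c (matrixGroup Γ)) :
    ∃ σ : SL(2, ℝ), toGL2 σ • (OnePoint.infty : OnePoint ℝ) = c ∧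
      shift 1 ∈ conj (Γ.comap proj) σ ∧
      ∀ g ∈ conj (Γ.comap proj) σ, g 1 0 = 0 → ∃ n : ℤ, g = shift n ∨ g = -shift n := by
  obtain ⟨σ, rfl⟩ := exists_smul_infty_eq c
  obtain ⟨_, ⟨q, hq, rfl⟩, hpar, hfix⟩ := hc
  rw [smul_smul, ← map_mul, smul_infty_eq_iff] at hfix
  set r := σ⁻¹ * (q * σ) with hr
  have hrm : r ∈ conj (Γ.comap proj) σ := by
    rw [mem_conj, hr]
    simpa [mul_assoc] using hq
  have hrp : (toGL2 r).IsParabolic := by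
    have : toGL2 r = (toGL2 σ)⁻¹ * toGL2 q * ((toGL2 σ)⁻¹)⁻¹ := by
      rw [hr, map_mul, map_mul, map_inv, inv_inv, mul_assoc]
    rw [this]
    simpa using hpar
  have hneg : -1 ∈ conj (Γ.comap proj) σ := by
    rw [mem_conj]
    simpa using neg_one_mem_comap Γ
  -- A parabolic upper triangular matrix of determinant 1 is a nontrivial shift up to sign, and the
  -- sign can be removed because `-1` lies in the full preimage of `Γ`.
  have hsx : ∃ x ≠ 0, shift x ∈ conj (Γ.comap proj) σ := by
    rw [GeneralLinearGroup.isParabolic_iff_of_upperTriangular_of_det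
      (Or.inl (by ext; simp)) hfix] at hrp
    rcases hrp with ⟨x, hx, h⟩ | ⟨x, hx, h⟩
    · refine ⟨x, hx, ?_⟩
      have : r = shift x := Subtype.ext (congrArg Units.val h)
      rwa [← this]
    · refine ⟨x, hx, ?_⟩
      have : r = -shift x := Subtype.ext (congrArg Units.val h)
      have h2 := (conj (Γ.comap proj) σ).mul_mem hneg hrm
      rw [this] at h2
      simpa using h2
  obtain ⟨x, hx, hxm⟩ := hsx
  obtain ⟨δ, hδ, h1, h2⟩ := exists_normalized hx hxm hneg
  rw [conj_conj] at h1 h2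
  refine ⟨σ * δ, ?_, h1, h2⟩
  rw [smul_infty_eq_iff, inv_mul_cancel_left, hδ]

/-- The stabilizer of `∞` when the unit translation belongs to `Γ` and is primitive. -/
theorem eq_shift_of_primitive {Γ : Subgroup PSL(2, ℝ)} [DiscreteTopology Γ]
    (hmem : translation ∈ Γ)
    (hprim : ∀ γ ∈ Γ, ∀ n : ℕ, γ ^ n = translation → γ = translation)
    {g : SL(2, ℝ)} (hg : g ∈ Γ.comap proj) (hg0 : g 1 0 = 0) :
    ∃ n : ℤ, g = shift n ∨ g = -shift n := by
  have h1 : shift 1 ∈ Γ.comap proj := hmem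
  obtain ⟨w, hw, hwm, hgen⟩ := exists_generator_translations one_ne_zero h1
  obtain ⟨n, hn⟩ := hgen 1 h1
  -- Primitivity concerns natural exponents only, so the integer `n` must be shown positive before
  -- it is applied.
  have hn0 : 0 < n := by
    by_contra! h
    have : (n : ℝ) ≤ 0 := by exact_mod_cast h
    nlinarith
  have hw1 : w = 1 := by
    have := hprim (proj (shift w)) hwm n.toNat (by
      rw [← map_pow, ← proj_shift_one, hn, shift_zpow, ← zpow_natCast, Int.toNat_of_nonneg hn0.le])
    rw [← proj_shift_one, proj_eq_proj_iff] at this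
    rcases this with h | h
    · exact shift_injective h
    · have := congrArg (fun g : SL(2, ℝ) => g 0 0) h
      norm_num [coe_shift] at this
  subst hw1
  obtain ⟨b, hb⟩ := eq_shift_of_upper one_ne_zero h1 hg hg0
  have hbm : shift b ∈ Γ.comap proj := by
    rcases hb with rfl | rfl
    · exact hg
    · rw [Subgroup.mem_comap, proj_neg] at hg
      exact hg
  obtain ⟨m, hm⟩ := hgen _ hbm
  rw [mul_one] at hm
  exact ⟨m, hm ▸ hb⟩

end Fuchsian

end

/-! ### Hyperbolic area and fundamental domains -/

noncomputable section

namespace Fuchsian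

open Matrix MeasureTheory Filter Topology

theorem im_smul_eq (g : SL(2, ℝ)) (z : ℍ) :
    (g • z).im = z.im / ((g 1 0 * z.re + g 1 1) ^ 2 + (g 1 0 * z.im) ^ 2) := by
  have h := UpperHalfPlane.im_smul_eq_div_normSq (toGL2 g) z
  have h2 : (toGL2 g).det.val = 1 := by simp
  rw [h2, abs_one, one_mul] at h
  refine Eq.trans h ?_
  congr 1
  simp [UpperHalfPlane.denom, Complex.normSq_apply, sq]

theorem denom_sq_pos (g : SL(2, ℝ)) (z : ℍ) :
    0 < (g 1 0 * z.re + g 1 1) ^ 2 + (g 1 0 * z.im) ^ 2 := by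
  have h := (g • z).im_pos
  rw [im_smul_eq] at h
  by_contra! h2
  exact absurd h (not_lt.2 (div_nonpos_of_nonneg_of_nonpos z.im_pos.le h2))

theorem shift_smul_im (x : ℝ) (z : ℍ) : (shift x • z).im = z.im := by
  rw [im_smul_eq]; simp [coe_shift]

theorem shift_smul_re (x : ℝ) (z : ℍ) : (shift x • z).re = z.re + x := by
  rw [UpperHalfPlane.specialLinearGroup_apply, ← UpperHalfPlane.coe_re]
  simp [coe_shift]

theorem sl_neg_smul (g : SL(2, ℝ)) (z : ℍ) : -g • z = g • z := by
  rw [← proj_smul, proj_neg, proj_smul]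

theorem isOpen_setOf_lt_im (h : ℝ) : IsOpen {z : ℍ | h < z.im} :=
  isOpen_lt continuous_const UpperHalfPlane.continuous_im

/-- The half-strip of width one above height `h`. -/
def strip (h : ℝ) : Set ℍ := {z | 0 ≤ z.re ∧ z.re < 1 ∧ h < z.im}

theorem measurableSet_strip (h : ℝ) : MeasurableSet (strip h) :=
  ((measurableSet_le measurable_const UpperHalfPlane.continuous_re.measurable).inter
    ((measurableSet_lt UpperHalfPlane.continuous_re.measurable measurable_const).inter
    (measurableSet_lt measurable_const UpperHalfPlane.continuous_im.measurable)))

theorem volume_strip {h : ℝ} (hh : 0 < h) :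
    (volume : Measure ℍ) (strip h) = ENNReal.ofReal (1 / h) := by
  rw [UpperHalfPlane.volume_eq_lintegral]
  have himg : UpperHalfPlane.coe '' strip h =
      Complex.measurableEquivRealProd ⁻¹' (Set.Ico (0 : ℝ) 1 ×ˢ Set.Ioi h) := by
    ext z
    simp only [Set.mem_image, Set.mem_preimage, Set.mem_prod, Set.mem_Ico, Set.mem_Ioi,
      Complex.measurableEquivRealProd_apply]
    constructor
    · rintro ⟨w, ⟨h1, h2, h3⟩, rfl⟩
      exact ⟨⟨h1, h2⟩, h3⟩
    · rintro ⟨⟨h1, h2⟩, h3⟩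
      exact ⟨⟨z, hh.trans h3⟩, ⟨h1, h2, h3⟩, rfl⟩
  rw [himg]
  have hpre := Complex.volume_preserving_equiv_real_prod.setLIntegral_comp_preimage_emb
    Complex.measurableEquivRealProd.measurableEmbedding
    (fun p : ℝ × ℝ => (((1 / ‖p.2‖₊) ^ 2 : NNReal) : ENNReal)) (Set.Ico (0 : ℝ) 1 ×ˢ Set.Ioi h)
  refine Eq.trans hpre ?_
  rw [Measure.volume_eq_prod, ← Measure.prod_restrict, lintegral_prod _ (by fun_prop)]
  simp only [lintegral_const, Measure.restrict_apply_univ, Real.volume_Ico, sub_zero,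
    ENNReal.ofReal_one, mul_one]
  have : ∀ y ∈ Set.Ioi h, (((1 / ‖y‖₊) ^ 2 : NNReal) : ENNReal) = ENNReal.ofReal (y ^ (-2 : ℝ)) := by
    intro y hy
    have hy0 : 0 < y := hh.trans hy
    rw [ENNReal.ofReal, ENNReal.coe_inj]
    apply NNReal.eq
    rw [Real.coe_toNNReal _ (by positivity), Real.rpow_neg hy0.le]
    simp
  rw [setLIntegral_congr_fun measurableSet_Ioi this, ← ofReal_integral_eq_lintegral_ofReal
    (integrableOn_Ioi_rpow_of_lt (by norm_num) hh), integral_Ioi_rpow_of_lt (by norm_num) hh]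
  · congr 1
    norm_num [Real.rpow_neg hh.le]
  · exact (ae_restrict_mem measurableSet_Ioi).mono fun y hy => by
      have : 0 < y := hh.trans hy
      positivity

instance : (volume : Measure ℍ).IsOpenPosMeasure where
  open_pos U hU hne h0 := by
    rw [UpperHalfPlane.volume_eq_lintegral] at h0
    have hO : IsOpen (UpperHalfPlane.coe '' U) := UpperHalfPlane.isOpenEmbedding_coe.isOpenMap _ hU
    rw [lintegral_eq_zero_iff (by fun_prop)] at h0
    have h1 : ∀ᵐ z ∂(volume.restrict (UpperHalfPlane.coe '' U)), False := by
      filter_upwards [h0, ae_restrict_mem hO.measurableSet] with z hz hzU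
      obtain ⟨w, -, rfl⟩ := hzU
      have := w.im_ne_zero
      simp at hz
      exact this hz
    rw [ae_iff] at h1
    simp only [not_false_eq_true, Set.ofPred_true, Measure.restrict_apply_univ] at h1
    exact (hO.measure_pos volume (hne.image _)).ne' h1

theorem volume_singleton (z : ℍ) : (volume : Measure ℍ) {z} = 0 := by
  rw [UpperHalfPlane.volume_eq_lintegral, Set.image_singleton]
  simp

/-! ### The action of a discrete subgroup of `PSL(2, ℝ)` on the half-plane -/

theorem smul_eq_proj (g : SL(2, ℝ)) (Γ : Subgroup PSL(2, ℝ)) (hg : proj g ∈ Γ) (z : ℍ) :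
    (⟨proj g, hg⟩ : Γ) • z = g • z := proj_smul g z

instance (Γ : Subgroup PSL(2, ℝ)) : ContinuousConstSMul Γ ℍ where
  continuous_const_smul := by
    rintro ⟨g, hg⟩
    obtain ⟨g, rfl⟩ := proj_surjective g
    simp only [smul_eq_proj]
    exact continuous_const_smul g

instance (Γ : Subgroup PSL(2, ℝ)) : SMulInvariantMeasure Γ ℍ volume where
  measure_preimage_smul := by
    rintro ⟨g, hg⟩ s hs
    obtain ⟨g, rfl⟩ := proj_surjective g
    simp only [smul_eq_proj]
    exact SMulInvariantMeasure.measure_preimage_smul (μ := (volume : Measure ℍ)) (toGL2 g) hs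

theorem volume_smul_set (g : SL(2, ℝ)) (s : Set ℍ) :
    (volume : Measure ℍ) ((g • ·) '' s) = volume s :=
  measure_smul (μ := (volume : Measure ℍ)) (toGL2 g) s

instance (Γ : Subgroup PSL(2, ℝ)) [DiscreteTopology Γ] : Countable Γ := by
  have : SecondCountableTopology (Matrix (Fin 2) (Fin 2) ℝ) :=
    inferInstanceAs (SecondCountableTopology (Fin 2 → Fin 2 → ℝ))
  have h1 : SecondCountableTopology SL(2, ℝ) :=
    (Matrix.SpecialLinearGroup.isClosedEmbedding_val (n := Fin 2) (R := ℝ)).isEmbedding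
      |>.secondCountableTopology
  have : Countable (Γ.comap proj) := countable_of_Lindelof_of_discrete
  let f : Γ.comap proj → Γ := fun g => ⟨proj g, g.2⟩
  refine Function.Surjective.countable (f := f) ?_
  rintro ⟨g, hg⟩
  obtain ⟨g, rfl⟩ := proj_surjective g
  exact ⟨⟨g, hg⟩, rfl⟩

instance (Γ : Subgroup PSL(2, ℝ)) [DiscreteTopology Γ] : ProperlyDiscontinuousSMul Γ ℍ where
  finite_disjoint_inter_image {K L} hK hL := by
    have h := finite_disjoint_inter_image (Γ := Γ.comap proj) hK hL
    let f : Γ.comap proj → Γ := fun g => ⟨proj g, g.2⟩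
    refine (h.image f).subset ?_
    rintro ⟨g, hg⟩ hne
    obtain ⟨g, rfl⟩ := proj_surjective g
    refine ⟨⟨g, hg⟩, ?_, rfl⟩
    simp only [smul_eq_proj, Set.mem_ofPred_eq] at hne
    exact hne

/-- A nontrivial element with a fixed point in `ℍ` is elliptic and fixes only that point; countably
many points form a null set. -/
theorem ae_forall_smul_ne (Γ : Subgroup PSL(2, ℝ)) [DiscreteTopology Γ] :
    ∀ᵐ z : ℍ, ∀ γ : Γ, γ ≠ 1 → γ • z ≠ z := by
  rw [ae_all_iff]
  rintro ⟨g, hg⟩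
  obtain ⟨g, rfl⟩ := proj_surjective g
  by_cases h1 : (⟨proj g, hg⟩ : Γ) = 1
  · exact Eventually.of_forall fun _ h => absurd h1 h
  have hs : {z : ℍ | g • z = z}.Subsingleton := by
    intro z hz w hw
    have hdet : 0 < (toGL2 g).val.det := by simp
    have hcen : toGL2 g ∉ Subgroup.center (GL (Fin 2) ℝ) := by
      intro hc
      apply h1
      rw [Subtype.ext_iff]
      change proj g = 1
      rw [← map_one proj, proj_eq_proj_iff, ← mem_center_iff_eq, Subgroup.mem_center_iff]
      intro k
      have := Subgroup.mem_center_iff.1 hc (toGL2 k)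
      rw [← map_mul, ← map_mul] at this
      exact Subtype.ext (congrArg Units.val this)
    have hell := UpperHalfPlane.isElliptic_of_exists_smul_eq_self hdet hcen ⟨z, hz⟩
    rw [(UpperHalfPlane.gl_smul_eq_self_iff_eq_fixedPt hdet hell).1 hz,
      (UpperHalfPlane.gl_smul_eq_self_iff_eq_fixedPt hdet hell).1 hw]
  have h0 : (volume : Measure ℍ) {z : ℍ | g • z = z} = 0 := by
    rcases hs.eq_empty_or_singleton with h | ⟨z, h⟩
    · rw [h]; simp
    · rw [h]; exact volume_singleton z
  rw [ae_iff]
  refine measure_mono_null ?_ h0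
  intro z hz
  simp only [smul_eq_proj, Set.mem_ofPred_eq] at hz ⊢
  tauto

/-- A properly discontinuous action with almost everywhere trivial stabilizers has a measurable
fundamental domain. -/
theorem exists_isFundamentalDomain (G X : Type*) [Group G] [Countable G] [TopologicalSpace X]
    [MulAction G X] [ContinuousConstSMul G X] [ProperlyDiscontinuousSMul G X] [T2Space X]
    [LocallyCompactSpace X] [SecondCountableTopology X] [MeasurableSpace X] [BorelSpace X]
    (μ : Measure X) (hfree : ∀ᵐ x ∂μ, ∀ g : G, g ≠ 1 → g • x ≠ x) :
    ∃ s : Set X, IsFundamentalDomain G s μ := by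
  let X₀ : Set X := {x | ∀ g : G, g ≠ 1 → g • x ≠ x}
  have hU : ∀ x ∈ X₀, ∃ U : Set X, IsOpen U ∧ x ∈ U ∧
      ∀ g : G, g ≠ 1 → ∀ y ∈ U, g • y ∉ U := by
    intro x hx
    obtain ⟨U, hU, hd⟩ := ProperlyDiscontinuousSMul.exists_nhds_disjoint_image G x
    refine ⟨interior U, isOpen_interior, mem_interior_iff_mem_nhds.2 hU, fun g hg y hy hgy => ?_⟩
    exact Set.disjoint_left.1 (hd g (hx g hg)) ⟨y, interior_subset hy, rfl⟩ (interior_subset hgy)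
  choose! U hUo hxU hUd using hU
  obtain ⟨S, hSX, hSc, hS⟩ := TopologicalSpace.countable_cover_nhdsWithin (s := X₀) (f := U)
    fun x hx => mem_nhdsWithin_of_mem_nhds ((hUo x hx).mem_nhds (hxU x hx))
  obtain ⟨V, hVo, hVd, hV⟩ : ∃ V : ℕ → Set X, (∀ n, IsOpen (V n)) ∧
      (∀ n, ∀ g : G, g ≠ 1 → ∀ y ∈ V n, g • y ∉ V n) ∧ X₀ ⊆ ⋃ n, V n := by
    rcases S.eq_empty_or_nonempty with rfl | hne
    · exact ⟨fun _ => ∅, by simp, by simp, by simpa using hS⟩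
    · obtain ⟨f, hf⟩ := hSc.exists_eq_range hne
      have hfX : ∀ n, f n ∈ X₀ := fun n => hSX (hf ▸ Set.mem_range_self n)
      refine ⟨fun n => U (f n), fun n => hUo _ (hfX n), fun n => hUd _ (hfX n), ?_⟩
      rw [hf] at hS
      simpa using hS
  -- An orbit is represented in the first `V n` that it meets, and there only once, since nontrivial
  -- elements move `V n` off itself.
  let P : ℕ → Set X := fun n => V n \ ⋃ m < n, ⋃ g : G, (g • ·) ⁻¹' V m
  have hPm : MeasurableSet (⋃ n, P n) := by
    refine MeasurableSet.iUnion fun n => (hVo n).measurableSet.diff ?_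
    refine (isOpen_biUnion fun m _ => isOpen_iUnion fun g => ?_).measurableSet
    exact (hVo m).preimage (continuous_const_smul g)
  have hP : ∀ n x, x ∈ P n ↔ x ∈ V n ∧ ∀ m < n, ∀ g : G, g • x ∉ V m := by
    intro n x
    simp [P]
  refine ⟨⋃ n, P n, hPm.nullMeasurableSet, ?_, ?_⟩
  · filter_upwards [hfree] with x hx
    have hex : ∃ n, ∃ g : G, g • x ∈ V n := by
      obtain ⟨n, hn⟩ := Set.mem_iUnion.1 (hV hx)
      exact ⟨n, 1, by simpa using hn⟩
    classical
    obtain ⟨g, hg⟩ := Nat.find_spec hex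
    refine ⟨g, Set.mem_iUnion.2 ⟨Nat.find hex, (hP _ _).2 ⟨hg, fun m hm k hk => ?_⟩⟩⟩
    exact Nat.find_min hex hm ⟨k * g, by rwa [mul_smul]⟩
  · have key : ∀ g : G, ∀ x, x ∈ ⋃ n, P n → g • x ∈ ⋃ n, P n → g = 1 := by
      intro g x hx hgx
      obtain ⟨n, hn⟩ := Set.mem_iUnion.1 hx
      obtain ⟨m, hm⟩ := Set.mem_iUnion.1 hgx
      rw [hP] at hn hm
      rcases lt_trichotomy m n with h | rfl | h
      · exact absurd hm.1 (hn.2 m h g)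
      · by_contra hg
        exact hVd m g hg x hn.1 hm.1
      · exact absurd hn.1 (by simpa using hm.2 n h g⁻¹)
    intro a b hab
    refine Disjoint.aedisjoint (Set.disjoint_left.2 ?_)
    rintro _ ⟨x, hx, rfl⟩ ⟨y, hy, hxy⟩
    simp only at hxy
    apply hab
    have h := key (b⁻¹ * a) x hx (by rw [mul_smul, ← hxy, inv_smul_smul]; exact hy)
    exact (inv_mul_eq_one.1 h).symm

/-- A set meeting every orbit is at least as large as a fundamental domain. -/
theorem measure_le_of_covers {G X : Type*} [Group G] [Countable G] [MulAction G X]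
    [MeasurableSpace X] [MeasurableConstSMul G X] {μ : Measure X} [SMulInvariantMeasure G X μ]
    {s t : Set X} (hs : IsFundamentalDomain G s μ) (ht : ∀ x, ∃ g : G, g • x ∈ t) :
    μ s ≤ μ t := by
  rw [hs.measure_eq_tsum t]
  refine le_trans (measure_mono ?_) (measure_iUnion_le _)
  intro x hx
  obtain ⟨g, hg⟩ := ht x
  exact Set.mem_iUnion.2 ⟨g⁻¹, Set.mem_smul_set_iff_inv_smul_mem.2 (by simpa using hg), hx⟩

/-- Existence of a fundamental domain matters here: otherwise `covolume` would be its default value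
0. -/
theorem exists_fundamentalDomain_area (Γ : Subgroup PSL(2, ℝ)) [DiscreteTopology Γ] :
    ∃ s : Set ℍ, IsFundamentalDomain Γ s ∧ area Γ = ((volume : Measure ℍ) s).toReal := by
  obtain ⟨s, hs⟩ := exists_isFundamentalDomain Γ ℍ volume (ae_forall_smul_ne Γ)
  exact ⟨s, hs, by rw [area, hs.covolume_eq_volume]⟩

end Fuchsian

end

/-! ### Compactness of the completed quotient gives finite area -/

noncomputable section

namespace Fuchsian

open Matrix MeasureTheory Filter Topology

namespace ExtendedHalfPlane

variable {Γ : Subgroup PSL(2, ℝ)}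

theorem smul_point (γ : Γ) (z : ℍ) : γ • (point z : ExtendedHalfPlane Γ) = point (γ • z) := rfl

theorem smul_cusp (γ : Γ) (c : Cusp Γ) :
    γ • (cusp c : ExtendedHalfPlane Γ) = cusp ⟨(γ : PSL(2, ℝ)) • c.1, isCusp_smul γ c.2⟩ := rfl

theorem smul_cusp_ne_point (γ : Γ) (c : Cusp Γ) (z : ℍ) :
    γ • (cusp c : ExtendedHalfPlane Γ) ≠ point z := by
  rw [smul_cusp]
  exact nofun

theorem smul_cusp_eq_iff (γ : Γ) (c c' : Cusp Γ) :
    γ • (cusp c : ExtendedHalfPlane Γ) = cusp c' ↔ (γ : PSL(2, ℝ)) • c.1 = c'.1 := by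
  constructor
  · intro h
    injection h with h
    exact congrArg Subtype.val h
  · exact fun h => congrArg cusp (Subtype.ext h)

theorem isOpen_iff {V : Set (ExtendedHalfPlane Γ)} :
    IsOpen V ↔ IsOpen {z : ℍ | point z ∈ V} ∧
    ∀ (σ : SL(2, ℝ)) (h : IsCusp (toGL2 σ • (OnePoint.infty : OnePoint ℝ)) (matrixGroup Γ)),
      cusp ⟨_, h⟩ ∈ V → ∀ᶠ z in UpperHalfPlane.atImInfty, point (σ • z) ∈ V := Iff.rfl

end ExtendedHalfPlane

open ExtendedHalfPlane

theorem exists_shift_smul_mem_strip {h : ℝ} {z : ℍ} (hz : h < z.im) :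
    ∃ n : ℤ, shift n • z ∈ strip h := by
  refine ⟨-⌊z.re⌋, ?_⟩
  rw [strip, Set.mem_ofPred_eq, shift_smul_im, shift_smul_re]
  have h1 := Int.floor_le z.re
  have h2 := Int.lt_floor_add_one z.re
  push_cast
  exact ⟨by linarith, by linarith, hz⟩

theorem shift_int_mem {H : Subgroup SL(2, ℝ)} (hT : shift 1 ∈ H) (n : ℤ) : shift n ∈ H := by
  rw [← mul_one (n : ℝ), shift_zpow]
  exact H.zpow_mem hT n

/-- Upper triangular matrices preserve neighbourhoods of `i∞`. -/
theorem eventually_lt_im_smul {u : SL(2, ℝ)} (hu : u 1 0 = 0) (A : ℝ) :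
    ∀ᶠ z in UpperHalfPlane.atImInfty, A < (u • z).im := by
  rw [Filter.Eventually, UpperHalfPlane.atImInfty_mem]
  refine ⟨(|A| + 1) * u 1 1 ^ 2, fun z hz => ?_⟩
  have hd := denom_sq_pos u z
  rw [Set.mem_ofPred_eq, im_smul_eq]
  rw [hu] at hd ⊢
  simp only [zero_mul, zero_add, ne_eq, OfNat.ofNat_ne_zero, not_false_eq_true, zero_pow,
    add_zero] at hd ⊢
  rw [lt_div_iff₀ hd]
  have := le_abs_self A
  nlinarith

/-- The `Γ`-saturation of a compact neighbourhood's interior works. Invariance of `V` is what makes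
its image in the quotient open. -/
theorem exists_nhd_point {Γ : Subgroup PSL(2, ℝ)} (z : ℍ) :
    ∃ (V : Set (ExtendedHalfPlane Γ)) (t : Set ℍ), IsOpen V ∧ point z ∈ V ∧
      (∀ γ : Γ, ∀ v, γ • v ∈ V ↔ v ∈ V) ∧ (volume : Measure ℍ) t ≠ ⊤ ∧
      ∀ y, point y ∈ V → ∃ γ : Γ, γ • y ∈ t := by
  obtain ⟨K, hK, hKz⟩ := exists_compact_mem_nhds z
  refine ⟨{v | ∃ γ : Γ, ∃ y ∈ interior K, γ • v = point y}, K, ?_, ?_, ?_,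
    hK.measure_lt_top.ne, ?_⟩
  · rw [ExtendedHalfPlane.isOpen_iff]
    refine ⟨?_, ?_⟩
    · have : {x : ℍ | (point x : ExtendedHalfPlane Γ) ∈
          {v | ∃ γ : Γ, ∃ y ∈ interior K, γ • v = point y}} =
          ⋃ γ : Γ, (γ • ·) ⁻¹' interior K := by
        ext x
        simp [smul_point]
      rw [this]
      exact isOpen_iUnion fun γ => isOpen_interior.preimage (continuous_const_smul γ)
    · rintro σ h ⟨γ, y, -, hy⟩
      exact absurd hy (smul_cusp_ne_point _ _ _)
  · exact ⟨1, z, mem_interior_iff_mem_nhds.2 hKz, one_smul _ _⟩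
  · intro γ v
    constructor
    · rintro ⟨δ, y, hy, h⟩
      exact ⟨δ * γ, y, hy, by rw [mul_smul, h]⟩
    · rintro ⟨δ, y, hy, h⟩
      exact ⟨δ * γ⁻¹, y, hy, by rw [mul_smul, inv_smul_smul, h]⟩
  · rintro y ⟨γ, x, hx, h⟩
    rw [smul_point] at h
    cases h
    exact ⟨γ, interior_subset hx⟩

/-- Here `V` is the saturation of a horoball with its cusp. Unit translations of the stabilizer move
any point of the horoball into a half-strip of width one, whose area is finite. -/
theorem exists_nhd_cusp {Γ : Subgroup PSL(2, ℝ)} [DiscreteTopology Γ] (c : Cusp Γ) :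
    ∃ (V : Set (ExtendedHalfPlane Γ)) (t : Set ℍ), IsOpen V ∧ cusp c ∈ V ∧
      (∀ γ : Γ, ∀ v, γ • v ∈ V ↔ v ∈ V) ∧ (volume : Measure ℍ) t ≠ ⊤ ∧
      ∀ y, point y ∈ V → ∃ γ : Γ, γ • y ∈ t := by
  obtain ⟨c, hc⟩ := c
  obtain ⟨σ, rfl, hT, -⟩ := exists_cusp_normalization hc
  set V : Set (ExtendedHalfPlane Γ) := {v | ∃ γ : Γ, γ • v = cusp ⟨_, hc⟩ ∨
    ∃ y : ℍ, 1 < y.im ∧ γ • v = point (σ • y)} with hV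
  have hpt : ∀ x : ℍ, point x ∈ V ↔ ∃ γ : Γ, 1 < (σ⁻¹ • γ • x).im := by
    intro x
    constructor
    · rintro ⟨γ, h | ⟨y, hy, h⟩⟩
      · rw [smul_point] at h
        cases h
      · rw [smul_point] at h
        injection h with h
        exact ⟨γ, by rwa [h, inv_smul_smul]⟩
    · rintro ⟨γ, h⟩
      exact ⟨γ, Or.inr ⟨_, h, by rw [smul_inv_smul, smul_point]⟩⟩
  refine ⟨V, (σ • ·) '' strip 1, ?_, ⟨1, Or.inl (one_smul _ _)⟩, ?_, ?_, ?_⟩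
  · rw [ExtendedHalfPlane.isOpen_iff]
    refine ⟨?_, ?_⟩
    · have : {x : ℍ | (point x : ExtendedHalfPlane Γ) ∈ V} =
          ⋃ γ : Γ, (fun x => σ⁻¹ • γ • x) ⁻¹' {z | 1 < z.im} := by
        ext x
        simp [hpt]
      rw [this]
      exact isOpen_iUnion fun γ => (isOpen_setOf_lt_im 1).preimage
        ((continuous_const_smul σ⁻¹).comp (continuous_const_smul γ))
    · rintro τ h ⟨⟨γ, hγ⟩, h2 | ⟨y, hy, h2⟩⟩
      · obtain ⟨g, rfl⟩ := proj_surjective γ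
        have h3 := (smul_cusp_eq_iff _ _ _).1 h2
        change proj g • (toGL2 τ • (OnePoint.infty : OnePoint ℝ)) = _ at h3
        rw [proj_smul_boundary, smul_smul, ← map_mul, smul_infty_eq_iff] at h3
        refine (eventually_lt_im_smul h3 1).mono fun z hz => ?_
        rw [hpt]
        refine ⟨⟨proj g, hγ⟩, ?_⟩
        rwa [smul_eq_proj, ← mul_smul, ← mul_smul, mul_assoc]
      · exact absurd h2 (smul_cusp_ne_point _ _ _)
  · intro γ v
    constructor
    · rintro ⟨δ, h⟩
      exact ⟨δ * γ, by rwa [mul_smul]⟩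
    · rintro ⟨δ, h⟩
      exact ⟨δ * γ⁻¹, by rwa [mul_smul, inv_smul_smul]⟩
  · rw [volume_smul_set, volume_strip one_pos]
    exact ENNReal.ofReal_ne_top
  · intro y hy
    obtain ⟨γ, h⟩ := (hpt y).1 hy
    obtain ⟨n, hn⟩ := exists_shift_smul_mem_strip h
    have hm := shift_int_mem hT n
    rw [mem_conj, Subgroup.mem_comap] at hm
    refine ⟨⟨proj (σ * shift n * σ⁻¹), hm⟩ * γ, ?_⟩
    rw [mul_smul, smul_eq_proj]
    refine ⟨_, hn, ?_⟩
    simp only [mul_smul]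

/-- A Fuchsian group with compact completed quotient has finite covolume. -/
theorem volume_fundamentalDomain_ne_top {Γ : Subgroup PSL(2, ℝ)} [DiscreteTopology Γ]
    [CompactSpace (CompletedQuotient Γ)] {s : Set ℍ} (hs : IsFundamentalDomain Γ s) :
    (volume : Measure ℍ) s ≠ ⊤ := by
  have hloc : ∀ w : ExtendedHalfPlane Γ, ∃ (V : Set (ExtendedHalfPlane Γ)) (t : Set ℍ),
      IsOpen V ∧ w ∈ V ∧ (∀ γ : Γ, ∀ v, γ • v ∈ V ↔ v ∈ V) ∧ (volume : Measure ℍ) t ≠ ⊤ ∧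
      ∀ y, point y ∈ V → ∃ γ : Γ, γ • y ∈ t := by
    rintro (z | c)
    · exact exists_nhd_point z
    · exact exists_nhd_cusp c
  choose V t hVo hwV hVinv htop ht using hloc
  let q : ExtendedHalfPlane Γ → CompletedQuotient Γ := Quotient.mk _
  have hq : ∀ w v, q v ∈ q '' V w ↔ v ∈ V w := by
    intro w v
    constructor
    · rintro ⟨u, hu, huv⟩
      obtain ⟨γ, rfl⟩ := Quotient.exact huv
      exact (hVinv w γ v).1 hu
    · exact fun h => ⟨v, h, rfl⟩
  have hopen : ∀ w, IsOpen (q '' V w) := by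
    intro w
    refine (isOpen_coinduced (f := q)).2 ?_
    convert! hVo w using 1
    ext v
    exact hq w v
  obtain ⟨F, hF⟩ := isCompact_univ.elim_finite_subcover (fun w => q '' V w) hopen (by
    intro x _
    obtain ⟨w, rfl⟩ := Quotient.exists_rep x
    exact Set.mem_iUnion.2 ⟨w, w, hwV w, rfl⟩)
  have hcov : ∀ y : ℍ, ∃ γ : Γ, γ • y ∈ ⋃ w ∈ F, t w := by
    intro y
    obtain ⟨w, hw, hy⟩ := Set.mem_iUnion₂.1 (hF (Set.mem_univ (q (point y))))
    obtain ⟨γ, hγ⟩ := ht w y ((hq w _).1 hy)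
    exact ⟨γ, Set.mem_iUnion₂.2 ⟨w, hw, hγ⟩⟩
  refine ((measure_le_of_covers hs hcov).trans_lt ?_).ne
  refine (measure_biUnion_finset_le F t).trans_lt ?_
  exact ENNReal.sum_lt_top.2 fun w _ => (htop w).lt_top

end Fuchsian

end

/-! ### Horoball packings and the area they occupy -/

noncomputable section

namespace Fuchsian

open Matrix MeasureTheory Filter Topology

section Horoballs

variable {ι : Type*} {H : Subgroup SL(2, ℝ)} {σ : ι → SL(2, ℝ)} {h : ι → ℝ}

/-- The horoballs `{z | h i < im (σ i)⁻¹ z}` and their translates by `H` are pairwise disjoint or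
equal, and `H` acts on each of them through unit translations. -/
structure IsHoroballPacking (H : Subgroup SL(2, ℝ)) (σ : ι → SL(2, ℝ)) (h : ι → ℝ) : Prop where
  pos : ∀ i, 0 < h i
  separated : ∀ i j g, σ j * g * (σ i)⁻¹ ∈ H → g 1 0 ≠ 0 → 1 ≤ g 1 0 ^ 2 * (h i * h j)
  upper : ∀ i j g, σ j * g * (σ i)⁻¹ ∈ H → g 1 0 = 0 →
    i = j ∧ ∃ n : ℤ, g = shift n ∨ g = -shift n

theorem im_smul_mul_im_le {g : SL(2, ℝ)} (z : ℍ) :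
    g 1 0 ^ 2 * (z.im * (g • z).im) ≤ 1 := by
  rw [im_smul_eq, mul_div_assoc', mul_div_assoc', div_le_one (denom_sq_pos g z)]
  nlinarith [sq_nonneg (g 1 0 * z.re + g 1 1)]

/-- The horoballs of a packing only meet when they coincide. -/
theorem IsHoroballPacking.eq_of_mem (hp : IsHoroballPacking H σ h) {i j : ι} {g : SL(2, ℝ)}
    (hg : σ j * g * (σ i)⁻¹ ∈ H) {z : ℍ} (hz : h i < z.im) (hgz : h j < (g • z).im) :
    i = j ∧ ∃ n : ℤ, g = shift n ∨ g = -shift n := by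
  refine hp.upper i j g hg ?_
  by_contra hne
  have h1 := hp.separated i j g hg hne
  have h2 := im_smul_mul_im_le (g := g) z
  have h3 : h i * h j < z.im * (g • z).im :=
    mul_lt_mul'' hz hgz (hp.pos i).le (hp.pos j).le
  have h4 := mul_lt_mul_of_pos_left h3 (pow_pos (abs_pos.2 hne) 2)
  rw [sq_abs] at h4
  linarith

/-- The Euclidean shape of a horoball based at a finite point `g 0 0 / g 1 0`. -/
theorem sq_sub_lt_of_lt_im_inv {g : SL(2, ℝ)} (hg : g 1 0 ≠ 0) {k : ℝ} (hk : 0 < k) {z : ℍ}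
    (hz : k < (g⁻¹ • z).im) :
    (z.re - g 0 0 / g 1 0) ^ 2 + z.im ^ 2 < z.im * (1 / (g 1 0 ^ 2 * k)) := by
  have hd := denom_sq_pos g⁻¹ z
  rw [im_smul_eq, lt_div_iff₀ hd, coe_inv_eq] at hz
  simp only [of_apply, cons_val', cons_val_zero, cons_val_fin_one, cons_val_one] at hz
  rw [mul_one_div, lt_div_iff₀ (by positivity)]
  calc ((z.re - g 0 0 / g 1 0) ^ 2 + z.im ^ 2) * (g 1 0 ^ 2 * k)
      = k * ((-g 1 0 * z.re + g 0 0) ^ 2 + (-g 1 0 * z.im) ^ 2) := by field_simp; ring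
    _ < z.im := hz

/-- Just below the horoball at `∞` there is an open set missed by all horoballs. -/
theorem IsHoroballPacking.exists_open_disjoint (hp : IsHoroballPacking H σ h) {i₀ : ι}
    (h₀ : σ i₀ = 1) :
    ∃ E : Set ℍ, IsOpen E ∧ E.Nonempty ∧
      ∀ i, ∀ γ ∈ H, ∀ z ∈ E, ¬ h i < ((σ i)⁻¹ • γ • z).im := by
  set D := h i₀ with hD
  have hD0 : 0 < D := hp.pos i₀
  -- A horoball reaching such a box is almost of the maximal diameter `D`, with base point near `x`.
  -- Boxes at `0` and `D / 2` cannot both be hit: two such large horoballs would overlap.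
  let B : ℝ → Set ℍ := fun x => {z | |z.re - x| < D / 100 ∧ 99 / 100 * D < z.im ∧ z.im < D}
  have hBo : ∀ x, IsOpen (B x) := fun x =>
    (isOpen_lt (UpperHalfPlane.continuous_re.sub continuous_const).abs continuous_const).inter
      ((isOpen_lt continuous_const UpperHalfPlane.continuous_im).inter
        (isOpen_lt UpperHalfPlane.continuous_im continuous_const))
  have hBne : ∀ x, (B x).Nonempty := fun x =>
    ⟨⟨⟨x, 995 / 1000 * D⟩, by positivity⟩, by
      refine ⟨?_, ?_, ?_⟩
      · change |x - x| < _
        simpa using hD0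
      · change _ < 995 / 1000 * D; linarith
      · change 995 / 1000 * D < _; linarith⟩
  by_contra! hcon
  have hit : ∀ x, ∃ i, ∃ γ ∈ H, (γ * σ i) 1 0 ≠ 0 ∧
      |x - (γ * σ i) 0 0 / (γ * σ i) 1 0| < 11 / 100 * D ∧
      99 / 100 * D < 1 / ((γ * σ i) 1 0 ^ 2 * h i) := by
    intro x
    obtain ⟨i, γ, hγ, z, ⟨hz1, hz2, hz3⟩, hz⟩ := hcon (B x) (hBo x) (hBne x)
    have hk : γ⁻¹ * σ i = (σ i₀) * (γ⁻¹ * σ i) := by rw [h₀, one_mul]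
    have hmem : σ i₀ * (γ⁻¹ * σ i) * (σ i)⁻¹ ∈ H := by
      rw [h₀]; simpa using hγ
    have hz' : h i < ((γ⁻¹ * σ i)⁻¹ • z).im := by
      rwa [_root_.mul_inv_rev, inv_inv, mul_smul]
    set g := γ⁻¹ * σ i with hgdef
    -- Otherwise the horoball is the one at `∞` itself, and the box lies below it.
    have hc : g 1 0 ≠ 0 := by
      intro hc
      obtain ⟨rfl, n, hn⟩ := hp.upper _ _ _ hmem hc
      have : (g⁻¹ • z).im = z.im := by
        rcases hn with hn | hn
        · rw [hn, ← shift_neg, shift_smul_im]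
        · rw [hn, inv_neg, sl_neg_smul, ← shift_neg, shift_smul_im]
      rw [this] at hz'
      linarith
    have h1 := sq_sub_lt_of_lt_im_inv hc (hp.pos i) hz'
    have h2 := hp.separated _ _ _ hmem hc
    have hpos : 0 < g 1 0 ^ 2 * h i := mul_pos (by positivity) (hp.pos i)
    -- Separation from the horoball at `∞` bounds the Euclidean diameter.
    have h3 : 1 / (g 1 0 ^ 2 * h i) ≤ D := by
      rw [div_le_iff₀ hpos]
      linarith
    refine ⟨i, γ⁻¹, H.inv_mem hγ, hc, ?_, ?_⟩
    · set p := g 0 0 / g 1 0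
      have h4 : (z.re - p) ^ 2 < (D / 10) ^ 2 := by
        have := mul_le_mul_of_nonneg_left h3 z.im_pos.le
        nlinarith
      have h5 := abs_lt_of_sq_lt_sq h4 (by positivity)
      rw [abs_lt] at h5 hz1 ⊢
      constructor <;> linarith [h5.1, h5.2, hz1.1, hz1.2]
    · have h6 : z.im * z.im < z.im * (1 / (g 1 0 ^ 2 * h i)) := by
        nlinarith [sq_nonneg (z.re - g 0 0 / g 1 0)]
      have := lt_of_mul_lt_mul_left h6 z.im_pos.le
      linarith
  obtain ⟨i, γ, hγ, hc, hx, hd⟩ := hit 0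
  obtain ⟨j, γ', hγ', hc', hx', hd'⟩ := hit (D / 2)
  have hmem : σ j * ((γ' * σ j)⁻¹ * (γ * σ i)) * (σ i)⁻¹ ∈ H := by
    have : σ j * ((γ' * σ j)⁻¹ * (γ * σ i)) * (σ i)⁻¹ = γ'⁻¹ * γ := by group
    rw [this]
    exact H.mul_mem (H.inv_mem hγ') hγ
  set g := γ * σ i
  set g' := γ' * σ j
  -- Through this identity, separation says that the squared distance of the base points is at least
  -- the product of the diameters. Here the distance is positive and below `0.72 * D`, while both
  -- diameters exceed `0.99 * D`.
  have hentry : (g'⁻¹ * g) 1 0 = g 1 0 * g' 1 0 * (g' 0 0 / g' 1 0 - g 0 0 / g 1 0) := by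
    rw [coe_mul_eq, coe_inv_eq]
    simp
    field_simp
    ring
  set p := g 0 0 / g 1 0
  set p' := g' 0 0 / g' 1 0
  rw [abs_lt] at hx hx'
  have hpp : 0 < p' - p := by linarith [hx.1, hx'.2]
  have hpp' : p' - p < 72 / 100 * D := by linarith [hx.1, hx.2, hx'.1, hx'.2]
  have hsep := hp.separated i j _ hmem (by
    rw [hentry]
    exact mul_ne_zero (mul_ne_zero hc hc') hpp.ne')
  rw [hentry] at hsep
  have hi := hp.pos i
  have hj := hp.pos j
  rw [lt_div_iff₀ (by positivity)] at hd hd'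
  have h7 : (99 / 100 * D * (g 1 0 ^ 2 * h i)) * (99 / 100 * D * (g' 1 0 ^ 2 * h j)) < 1 := by
    have := mul_lt_mul'' hd hd' (by positivity) (by positivity)
    simpa using this
  have h8 : (p' - p) ^ 2 < (72 / 100 * D) ^ 2 := by gcongr
  have h9 : 0 < (g 1 0 ^ 2 * h i) * (g' 1 0 ^ 2 * h j) := by positivity
  nlinarith [mul_lt_mul_of_pos_left h8 h9, mul_pos h9 (pow_pos hD0 2)]

end Horoballs

/-- The total area of the cusp regions of a horoball packing is less than the covolume. -/
theorem IsHoroballPacking.sum_lt_area {Γ : Subgroup PSL(2, ℝ)} [DiscreteTopology Γ]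
    [CompactSpace (CompletedQuotient Γ)] {ι : Type*} [Fintype ι] {σ : ι → SL(2, ℝ)} {h : ι → ℝ}
    (hp : IsHoroballPacking (Γ.comap proj) σ h) {i₀ : ι} (h₀ : σ i₀ = 1) :
    ∑ i, 1 / h i < area Γ := by
  obtain ⟨s, hs, harea⟩ := exists_fundamentalDomain_area Γ
  have hfin := volume_fundamentalDomain_ne_top hs
  obtain ⟨E, hEo, hEne, hE⟩ := hp.exists_open_disjoint h₀
  obtain ⟨z₀, hz₀E, hz₀⟩ := Measure.exists_mem_of_measure_ne_zero_of_ae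
    (hEo.measure_pos volume hEne).ne' (ae_restrict_of_ae (ae_forall_smul_ne Γ))
  obtain ⟨U, hU, hUd⟩ := ProperlyDiscontinuousSMul.exists_nhds_disjoint_image Γ z₀
  -- Shrinking the gap around a point with trivial stabilizer makes it embed in the quotient; its
  -- positive area gives the strict inequality.
  let W := E ∩ interior U
  have hWo : IsOpen W := hEo.inter isOpen_interior
  have hWne : W.Nonempty := ⟨z₀, hz₀E, mem_interior_iff_mem_nhds.2 hU⟩
  let R : ι → Set ℍ := fun i => (σ i • ·) '' strip (h i)
  have hRpre : ∀ i, R i = ((σ i)⁻¹ • ·) ⁻¹' strip (h i) := fun i => by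
    ext z
    constructor
    · rintro ⟨y, hy, rfl⟩
      simpa using hy
    · exact fun hz => ⟨_, hz, by simp⟩
  have hRm : ∀ i, MeasurableSet (R i) := fun i => by
    rw [hRpre]
    exact (continuous_const_smul (σ i)⁻¹).measurable (measurableSet_strip _)
  have hRR : ∀ i j, ∀ γ : Γ, ∀ x ∈ R i, γ • x ∈ R j → i = j ∧ γ = 1 := by
    rintro i j ⟨γ, hγ⟩ _ ⟨y, hy, rfl⟩ hgx
    obtain ⟨g, rfl⟩ := proj_surjective γ
    rw [hRpre, Set.mem_preimage, smul_eq_proj, ← mul_smul, ← mul_smul] at hgx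
    have hmem : σ j * ((σ j)⁻¹ * (g * σ i)) * (σ i)⁻¹ ∈ Γ.comap proj := by
      have : σ j * ((σ j)⁻¹ * (g * σ i)) * (σ i)⁻¹ = g := by group
      rwa [this]
    rw [mul_assoc] at hgx
    obtain ⟨rfl, n, hn⟩ := hp.eq_of_mem hmem hy.2.2 hgx.2.2
    refine ⟨rfl, ?_⟩
    have hre : (((σ i)⁻¹ * (g * σ i)) • y).re = y.re + n := by
      rcases hn with hn | hn
      · rw [hn, shift_smul_re]
      · rw [hn, sl_neg_smul, shift_smul_re]
    have hn0 : n = 0 := by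
      have h1 := hgx.1
      have h2 := hgx.2.1
      rw [hre] at h1 h2
      have h3 := hy.1
      have h4 := hy.2.1
      have h5 : (n : ℝ) < 1 := by linarith
      have h6 : (-1 : ℝ) < n := by linarith
      norm_cast at h5 h6
      omega
    rw [hn0, Int.cast_zero, shift_zero] at hn
    have hg : g = σ i * ((σ i)⁻¹ * (g * σ i)) * (σ i)⁻¹ := by group
    rw [Subtype.ext_iff]
    change proj g = 1
    rw [← map_one proj, proj_eq_proj_iff]
    rcases hn with hn | hn
    · left; rw [hg, hn]; simp
    · right; rw [hg, hn]; simp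
  have hWR : ∀ i, ∀ γ : Γ, ∀ x ∈ W, γ • x ∉ R i := by
    rintro i ⟨γ, hγ⟩ x hx hgx
    obtain ⟨g, rfl⟩ := proj_surjective γ
    rw [hRpre, Set.mem_preimage, smul_eq_proj] at hgx
    exact hE i g hγ x hx.1 hgx.2.2
  have hWW : ∀ γ : Γ, ∀ x ∈ W, γ • x ∈ W → γ = 1 := by
    intro γ x hx hgx
    by_contra hne
    exact Set.disjoint_left.1 (hUd γ (hz₀ γ hne)) ⟨x, interior_subset hx.2, rfl⟩
      (interior_subset hgx.2)
  have hdisj : ∀ γ : Γ, ∀ x ∈ (⋃ i, R i) ∪ W, γ • x ∈ (⋃ i, R i) ∪ W → γ = 1 := by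
    rintro γ x (hx | hx) (hy | hy)
    · obtain ⟨i, hi⟩ := Set.mem_iUnion.1 hx
      obtain ⟨j, hj⟩ := Set.mem_iUnion.1 hy
      exact (hRR i j γ x hi hj).2
    · obtain ⟨i, hi⟩ := Set.mem_iUnion.1 hx
      exact absurd (by simpa using hi) (hWR i γ⁻¹ _ hy)
    · obtain ⟨i, hi⟩ := Set.mem_iUnion.1 hy
      exact absurd hi (hWR i γ _ hx)
    · exact hWW γ x hx hy
  have hUm : MeasurableSet (⋃ i, R i) := MeasurableSet.iUnion hRm
  -- A set larger than a fundamental domain would contain two points related by a nontrivial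
  -- element.
  have hle : (volume : Measure ℍ) ((⋃ i, R i) ∪ W) ≤ volume s := by
    by_contra! hlt
    obtain ⟨x, hx, y, hy, γ, hγ, rfl⟩ := hs.exists_ne_one_smul_eq
      (hUm.union hWo.measurableSet).nullMeasurableSet hlt
    exact hγ (hdisj γ x hx hy)
  rw [measure_union (Set.disjoint_left.2 fun x hx hxW => by
      obtain ⟨i, hi⟩ := Set.mem_iUnion.1 hx
      exact hWR i 1 x hxW (by simpa using hi)) hWo.measurableSet,
    measure_iUnion (fun i j hij => Set.disjoint_left.2 fun x hx hxj =>
      hij (hRR i j 1 x hx (by simpa using hxj)).1) hRm, tsum_fintype] at hle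
  have hR : ∀ i, (volume : Measure ℍ) (R i) = ENNReal.ofReal (1 / h i) := fun i => by
    rw [volume_smul_set, volume_strip (hp.pos i)]
  have hnn : ∀ i, 0 ≤ 1 / h i := fun i => (one_div_pos.2 (hp.pos i)).le
  simp only [hR] at hle
  rw [← ENNReal.ofReal_sum_of_nonneg fun i _ => hnn i] at hle
  have hW := hWo.measure_pos volume hWne
  have hlt : ENNReal.ofReal (∑ i, 1 / h i) < volume s :=
    (ENNReal.lt_add_right ENNReal.ofReal_ne_top hW.ne').trans_le hle
  rw [harea]
  exact (ENNReal.ofReal_lt_iff_lt_toReal (Finset.sum_nonneg fun i _ => hnn i) hfin).1 hlt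

end Fuchsian

end

/-! ### The packing attached to the cusps, and the resulting area bound -/

noncomputable section

namespace Fuchsian

open Matrix MeasureTheory Filter Topology ExtendedHalfPlane

theorem conj_shift_lower (g : SL(2, ℝ)) : (g * shift 1 * g⁻¹) 1 0 = -g 1 0 ^ 2 := by
  rw [conj_shift]; simp

/-- Normalised cusps give a horoball packing in which the horoball at `∞` may be enlarged up to
the height `1 / C`, for every lower bound `C` of the entries `c ≠ 0` of the group. -/
theorem isHoroballPacking_of_cusps {H : Subgroup SL(2, ℝ)} [DiscreteTopology H] {ι : Type*}
    [DecidableEq ι] {σ : ι → SL(2, ℝ)} {i₀ : ι} (h₀ : σ i₀ = 1) {C : ℝ} (hC1 : 1 ≤ C)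
    (hC : ∀ g ∈ H, g 1 0 ≠ 0 → C ≤ |g 1 0|) (hT : ∀ i, shift 1 ∈ conj H (σ i))
    (hstab : ∀ i, ∀ g ∈ conj H (σ i), g 1 0 = 0 → ∃ n : ℤ, g = shift n ∨ g = -shift n)
    (hineq : ∀ i j g, σ j * g * (σ i)⁻¹ ∈ H → g 1 0 = 0 → i = j) :
    IsHoroballPacking H σ (fun i => if i = i₀ then 1 / C else 1) := by
  have hC0 : 0 < C := one_pos.trans_le hC1
  -- A transition matrix `g` between two cusps is not in a conjugate of `H`, but the translation it
  -- carries over is. Its lower left entry is `-(g 1 0) ^ 2`, so the entry bounds apply to the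
  -- square.
  have hsq : ∀ i j g, σ j * g * (σ i)⁻¹ ∈ H → σ j * (g * shift 1 * g⁻¹) * (σ j)⁻¹ ∈ H := by
    intro i j g hg
    have h1 := H.mul_mem (H.mul_mem hg (mem_conj.1 (hT i))) (H.inv_mem hg)
    convert! h1 using 1
    group
  have hinv : ∀ i j g, σ j * g * (σ i)⁻¹ ∈ H → σ i * g⁻¹ * (σ j)⁻¹ ∈ H := by
    intro i j g hg
    convert! H.inv_mem hg using 1
    group
  have hbase : ∀ i g, σ i₀ * g * (σ i)⁻¹ ∈ H → g 1 0 ≠ 0 → C ≤ g 1 0 ^ 2 := by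
    intro i g hg hg0
    have h1 := hsq i i₀ g hg
    rw [h₀, one_mul, inv_one, mul_one] at h1
    have h2 := hC _ h1 (by rw [conj_shift_lower]; simpa using hg0)
    rwa [conj_shift_lower, abs_neg, abs_of_nonneg (sq_nonneg _)] at h2
  refine ⟨fun i => ?_, fun i j g hg hg0 => ?_, fun i j g hg hg0 => ?_⟩
  · split_ifs <;> positivity
  · by_cases hj : j = i₀
    · subst hj
      by_cases hi : i = j
      · subst hi
        rw [h₀, one_mul, inv_one, mul_one] at hg
        have h1 := hC g hg hg0
        have h2 : C ^ 2 ≤ |g 1 0| ^ 2 := by gcongr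
        rw [sq_abs] at h2
        simp only [if_true]
        rw [one_div_mul_one_div, mul_one_div, le_div_iff₀ (by positivity)]
        linarith
      · have h1 := hbase i g hg hg0
        simp only [if_true, if_neg hi, one_mul]
        rw [mul_one_div, le_div_iff₀ hC0]
        linarith
    · by_cases hi : i = i₀
      · subst hi
        have h1 := hbase j g⁻¹ (hinv _ _ _ hg) (by rw [coe_inv_eq]; simpa using hg0)
        rw [coe_inv_eq] at h1
        simp only [of_apply, cons_val', cons_val_zero, cons_val_fin_one, cons_val_one, neg_sq] at h1
        simp only [if_true, if_neg hj, mul_one]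
        rw [mul_one_div, le_div_iff₀ hC0]
        linarith
      · have h1 := one_le_abs_of_shift_mem (hT j) (hsq i j g hg)
          (by rw [conj_shift_lower]; simpa using hg0)
        rw [conj_shift_lower, abs_neg, abs_of_nonneg (sq_nonneg _)] at h1
        simpa only [if_neg hi, if_neg hj, mul_one] using h1
  · obtain rfl := hineq i j g hg hg0
    exact ⟨rfl, hstab i g hg hg0⟩

/-- Points of the half-plane have finite stabilizers. -/
theorem finite_stabilizer_point {Γ : Subgroup PSL(2, ℝ)} [DiscreteTopology Γ] (z : ℍ) :
    Finite (MulAction.stabilizer Γ (point z : ExtendedHalfPlane Γ)) := by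
  refine ((ProperlyDiscontinuousSMul.finite_stabilizer' Γ z).subset fun γ hγ => ?_).to_subtype
  have h : γ • (point z : ExtendedHalfPlane Γ) = point z := hγ
  rw [smul_point] at h
  injection h

theorem translation_zpow_injective : Function.Injective fun n : ℤ => translation ^ n := by
  intro n m h
  simp only [← proj_shift_one, ← map_zpow, ← shift_zpow, mul_one] at h
  rw [proj_eq_proj_iff] at h
  rcases h with h | h
  · exact_mod_cast shift_injective h
  · have := congrArg (fun g : SL(2, ℝ) => g 0 0) h
    norm_num [coe_shift] at this

theorem translation_smul_infty :
    translation • (OnePoint.infty : OnePoint ℝ) = OnePoint.infty := by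
  rw [← proj_shift_one, proj_smul_boundary, OnePoint.smul_infty_eq_self_iff]
  simp [coe_shift]

theorem isCusp_infty {Γ : Subgroup PSL(2, ℝ)} (hmem : translation ∈ Γ) :
    IsCusp OnePoint.infty (matrixGroup Γ) := by
  refine ⟨toGL2 (shift 1), ⟨shift 1, hmem, rfl⟩, ?_, translation_smul_infty⟩
  rw [GeneralLinearGroup.isParabolic_iff_of_upperTriangular_of_det (Or.inl (by ext; simp))
    (by simp [coe_shift])]
  refine Or.inl ⟨1, one_ne_zero, Units.ext ?_⟩
  rfl

/-- This forces the cusp `∞` to be one of the listed cone points, with order `⊤`. -/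
theorem infinite_stabilizer_infty {Γ : Subgroup PSL(2, ℝ)} (hmem : translation ∈ Γ) :
    Infinite (MulAction.stabilizer Γ
      (cusp ⟨OnePoint.infty, isCusp_infty hmem⟩ : ExtendedHalfPlane Γ)) := by
  set w : ExtendedHalfPlane Γ := cusp ⟨OnePoint.infty, isCusp_infty hmem⟩
  have hT : (⟨translation, hmem⟩ : Γ) ∈ MulAction.stabilizer Γ w :=
    (smul_cusp_eq_iff _ _ _).2 translation_smul_infty
  refine Infinite.of_injective
    (fun n : ℤ => (⟨_, hT⟩ : MulAction.stabilizer Γ w) ^ n) fun n m h => ?_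
  refine translation_zpow_injective ?_
  have := congrArg (fun γ : MulAction.stabilizer Γ w => ((γ : Γ) : PSL(2, ℝ))) h
  simpa using this

/-- The cusp of a point with infinite stabilizer, in normalised form. -/
theorem exists_normalization_of_infinite {Γ : Subgroup PSL(2, ℝ)} [DiscreteTopology Γ]
    {w : ExtendedHalfPlane Γ} (hw : Infinite (MulAction.stabilizer Γ w)) :
    ∃ (σ : SL(2, ℝ)) (h : IsCusp (toGL2 σ • (OnePoint.infty : OnePoint ℝ)) (matrixGroup Γ)),
      cusp ⟨_, h⟩ = w ∧ shift 1 ∈ conj (Γ.comap proj) σ ∧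
      ∀ g ∈ conj (Γ.comap proj) σ, g 1 0 = 0 → ∃ n : ℤ, g = shift n ∨ g = -shift n := by
  rcases w with z | ⟨c, hc⟩
  · exact absurd (finite_stabilizer_point z) (not_finite_iff_infinite.2 hw)
  · obtain ⟨σ, rfl, h1, h2⟩ := exists_cusp_normalization hc
    exact ⟨σ, hc, rfl, h1, h2⟩

/-- If all nonzero lower left entries of `Γ` have absolute value at least `C ≥ 1`, then the cusps
force the area to exceed `C + k₀ - 1`. -/
theorem lt_area_of_forall_le {Γ : Subgroup PSL(2, ℝ)} {p k : ℕ} {ν : Fin k → ℕ∞}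
    (hΓ : IsOfType Γ p k ν) (hmem : translation ∈ Γ)
    (hprim : ∀ γ ∈ Γ, ∀ n : ℕ, γ ^ n = translation → γ = translation) {C : ℝ} (hC1 : 1 ≤ C)
    (hC : ∀ g : SL(2, ℝ), proj g ∈ Γ → g 1 0 ≠ 0 → C ≤ |g 1 0|) :
    C + (Finset.univ.filter fun i => ν i = ⊤).card - 1 < area Γ := by
  have := hΓ.discrete
  have := hΓ.compact
  obtain ⟨x, hinj, hcard, hcov⟩ := hΓ.conePoints
  let w₀ : ExtendedHalfPlane Γ := cusp ⟨OnePoint.infty, isCusp_infty hmem⟩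
  have hw₀ : Infinite (MulAction.stabilizer Γ w₀) := infinite_stabilizer_infty hmem
  obtain ⟨i₀, hi₀⟩ := hcov w₀ fun h => by
    rw [h] at hw₀
    exact not_finite (⊥ : Subgroup Γ)
  have hν₀ : ν i₀ = ⊤ := by
    rw [← hcard i₀, ENat.card_eq_top]
    exact (MulAction.stabilizerEquivStabilizerOfOrbitRel hi₀).toEquiv.infinite_iff.1 hw₀
  let ι := {i // ν i = ⊤}
  have hdata : ∀ i : ι, ∃ (σ : SL(2, ℝ))
      (h : IsCusp (toGL2 σ • (OnePoint.infty : OnePoint ℝ)) (matrixGroup Γ)),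
      cusp ⟨_, h⟩ ∈ MulAction.orbit Γ (x i) ∧ shift 1 ∈ conj (Γ.comap proj) σ ∧
      (∀ g ∈ conj (Γ.comap proj) σ, g 1 0 = 0 → ∃ n : ℤ, g = shift n ∨ g = -shift n) ∧
      -- At `∞` the given coordinates must be kept, since `C` bounds entries in them; primitivity of
      -- the translation shows that they are already normalized.
      (i.1 = i₀ → σ = 1) := by
    rintro ⟨i, hi⟩
    by_cases hii : i = i₀
    · subst hii
      have h1 : toGL2 1 • (OnePoint.infty : OnePoint ℝ) = OnePoint.infty := by
        rw [map_one, one_smul]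
      refine ⟨1, by rw [h1]; exact isCusp_infty hmem, ?_, ?_, ?_, fun _ => rfl⟩
      · convert! hi₀ using 3
        exact congrArg cusp (Subtype.ext h1)
      · rw [mem_conj, one_mul, inv_one, mul_one]
        exact hmem
      · intro g hg hg0
        rw [mem_conj, one_mul, inv_one, mul_one] at hg
        exact eq_shift_of_primitive hmem hprim hg hg0
    · rw [← hcard i, ENat.card_eq_top] at hi
      obtain ⟨σ, h, h1, h2, h3⟩ := exists_normalization_of_infinite hi
      exact ⟨σ, h, h1 ▸ MulAction.mem_orbit_self _, h2, h3, fun h => absurd h hii⟩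
  choose σ hcusp horb hT hstab hone using hdata
  have hpack := isHoroballPacking_of_cusps (H := Γ.comap proj) (i₀ := (⟨i₀, hν₀⟩ : ι))
    (hone ⟨i₀, hν₀⟩ rfl) hC1 hC hT hstab (by
      intro i j g hg hg0
      apply Subtype.ext
      apply hinj
      rw [← MulAction.orbit_eq_iff.2 (horb i), ← MulAction.orbit_eq_iff.2 (horb j)]
      refine (MulAction.orbit_eq_iff.2 ⟨⟨_, hg⟩, ?_⟩).symm
      refine (smul_cusp_eq_iff _ _ _).2 ?_
      change proj _ • (toGL2 (σ i) • (OnePoint.infty : OnePoint ℝ)) = _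
      rw [proj_smul_boundary, smul_smul, ← map_mul, smul_infty_eq_iff]
      rw [inv_mul_cancel_right, inv_mul_cancel_left, hg0])
  refine lt_of_eq_of_lt ?_ (hpack.sum_lt_area (hone ⟨i₀, hν₀⟩ rfl))
  -- Each cusp contributes area 1, and the one at `∞` an extra `C - 1`.
  have hterm : ∀ i : ι, 1 / (if i = ⟨i₀, hν₀⟩ then 1 / C else 1) =
      1 + if i = ⟨i₀, hν₀⟩ then C - 1 else 0 := fun i => by
    split_ifs <;> simp
  rw [Finset.sum_congr rfl fun i _ => hterm i, Finset.sum_add_distrib, Finset.sum_ite_eq']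
  simp only [Finset.sum_const, Finset.card_univ, Finset.mem_univ, if_true, nsmul_eq_mul, mul_one]
  rw [Fintype.card_subtype]
  ring

end Fuchsian

end

/-! ### Conclusion -/

theorem theorem7p13 (Γ : Subgroup PSL(2, ℝ)) (p k : ℕ) (ν : Fin k → ℕ∞)
    (hΓ : Fuchsian.IsOfType Γ p k ν)
    (k₀ : ℕ) (hk₀ : k₀ = (Finset.univ.filter fun i => ν i = ⊤).card)
    (hmem : Fuchsian.translation ∈ Γ)
    (hprim : ∀ γ ∈ Γ, ∀ n : ℕ, γ ^ n = Fuchsian.translation → γ = Fuchsian.translation) :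
    ∃ g : SL(2, ℝ), Fuchsian.proj g ∈ Γ ∧
      1 ≤ |g 1 0| ∧ |g 1 0| < Fuchsian.area Γ - k₀ + 1 := by
  by_contra! hcon
  have := hΓ.discrete
  have h1 : ∀ g : SL(2, ℝ), Fuchsian.proj g ∈ Γ → g 1 0 ≠ 0 → 1 ≤ |g 1 0| := fun g hg hg0 =>
    Fuchsian.one_le_abs_of_shift_mem (H := Γ.comap Fuchsian.proj) hmem hg hg0
  -- The maximum with 1 supplies `1 ≤ C` without knowing in advance that the area is at least `k₀`.
  have h2 := Fuchsian.lt_area_of_forall_le hΓ hmem hprim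
    (le_max_left 1 (Fuchsian.area Γ - k₀ + 1))
    fun g hg hg0 => max_le (h1 g hg hg0) (hcon g hg (h1 g hg hg0))
  rw [← hk₀] at h2
  have h3 := le_max_right 1 (Fuchsian.area Γ - k₀ + 1)
  linarith
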